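/- All graphs are finite and simple. A graph $G$ is $H$-saturated if $G$ has no subgraph isomorphic to $H$, but adding to $G$ any edge between two distinct nonadjacent vertices creates such a subgraph; $\operatorname{sat}(n,H)$ is the minimum number of edges of an $H$-saturated graph on $n$ vertices. For positive integers $s,t$, the double star $S_{s,t}$ is the tree obtained from a star of order $s$ and a star of order $t$ by joining their central vertices by an edge. Let $1 \le s < t$ be integers. There is an integer $N=N(s,t)$ such that the following hold for every $n \ge N$. (1) $\displaystyle \operatorname{sat}(n,S_{s,t}) \ \ge\ \frac{s(t+1)n - s(t-s+2)}{2t+4}.$ (2) If $s\ge 2$ and $n \equiv s \pmod{2t+4}$, then equality holds in (1). (3) Every $S_{s,t}$-saturated graph on $n$ vertices with exactly $\operatorname{sat}(n,S_{s,t})$ edges has all its vertex degrees at least $s-1$. -/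

import Mathlib

open scoped SimpleGraph

/-- `G` is `H`-saturated: `G` has no subgraph isomorphic to `H`, but the addition to `G` of any
missing edge creates one. -/
def IsSaturated {W V : Type*} (H : SimpleGraph W) (G : SimpleGraph V) : Prop :=
  H.Free G ∧ ∀ x y : V, x ≠ y → ¬ G.Adj x y → H ⊑ G ⊔ SimpleGraph.edge x y

/-- The saturation number: the least number of edges of an `H`-saturated graph of order `n`. -/
noncomputable def satNumber {W : Type*} (n : ℕ) (H : SimpleGraph W) : ℕ :=
  sInf {m : ℕ | ∃ G : SimpleGraph (Fin n), IsSaturated H G ∧ G.edgeSet.ncard = m}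

/-- If `H` has an edge, there are `H`-saturated graphs of every order, so that the infimum in
`satNumber` is a minimum. -/
theorem exists_isSaturated_card_eq_satNumber {W : Type*} (n : ℕ) (H : SimpleGraph W)
    (hH : H ≠ ⊥) :
    ∃ G : SimpleGraph (Fin n), IsSaturated H G ∧ G.edgeSet.ncard = satNumber n H := by
  have hbot : H.Free (⊥ : SimpleGraph (Fin n)) := by
    rintro ⟨f⟩
    apply hH
    ext a b
    constructor
    · intro h
      exact (f.toHom.map_adj h).elim
    · intro h
      exact h.elim
  obtain ⟨G, -, hG⟩ :=
    Finite.exists_le_maximal (p := fun G : SimpleGraph (Fin n) => H.Free G) hbot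
  have hsat : IsSaturated H G := by
    refine ⟨hG.prop, fun x y hxy hadj => ?_⟩
    by_contra hfree
    have hle := hG.le_of_ge (y := G ⊔ SimpleGraph.edge x y) hfree le_sup_left
    exact hadj (hle (Or.inr (by simp [SimpleGraph.edge_adj, hxy])))
  exact Nat.sInf_mem (s := {m : ℕ | ∃ G : SimpleGraph (Fin n),
    IsSaturated H G ∧ G.edgeSet.ncard = m}) ⟨_, G, hsat, rfl⟩

/-- The double star `S_{s,t}`: the disjoint union of a star of order `s` and a star of order `t`,
together with an edge joining the two central vertices. -/
def doubleStar (s t : ℕ) (hs : 0 < s) (ht : 0 < t) : SimpleGraph (Fin s ⊕ Fin t) :=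
  (SimpleGraph.starGraph (⟨0, hs⟩ : Fin s) ⊕g SimpleGraph.starGraph (⟨0, ht⟩ : Fin t)) ⊔
    SimpleGraph.edge (Sum.inl ⟨0, hs⟩) (Sum.inr ⟨0, ht⟩)

/-! A double star sits on an edge `uv` exactly when the two degrees are at least `s` and `t` and the
two neighbourhoods together have at least `s + t` vertices (`doubleStar_isContained_iff`), so
saturation becomes a question about degrees and unions.

The lower bound is a discharging argument around the average degree `s(t+1)/(t+2)`, that of a star
with `t + 1` leaves whose leaves have degree `s - 1`. When all degrees are at least `s - 1`, only
vertices of degree `s - 1` (low vertices) and possibly large-degree vertices that pay for them can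
fall short. Joining two nonadjacent low vertices must make one of them the `s`-centre of a double
star, and its `t`-centre is then a good neighbour. Hence the low vertices without good neighbours
are pairwise adjacent, so there are at most `s` of them (`card_poorVerts_le`); they account for the
term `s(t-s+2)`. Every other low vertex is compensated by its good neighbours. Degrees above `t` can
afford the full payment of 2 to each low neighbour. Degree exactly `t` cannot, so it pays 1 unless
it is the only good neighbour, which happens for at most one payee (`eq_of_unique_isGoodNbr`).
Doubling the excess keeps half payments integral.

If some degree is below `s - 1`, almost every vertex has a neighbour of degree at least `s`, so
large vertices keep a surplus proportional to their degree, and the total excess grows linearly in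
`n` (`card_le_sum_excess`). For `s ≥ 2` a clique of order `s` together with paired stars, completed
on a bounded number of leftover vertices, has bounded excess (`excess_satNumber_le`). This excludes
such degrees for large `n`, which gives (3) and then (1); with no leftover vertices the construction
gives (2). -/

open Finset

/-! ### Neighbourhoods and the degree criterion for double stars -/

open Classical in
/-- The set of neighbours of a vertex, as a finite set. -/
noncomputable def nbhd {V : Type*} [Fintype V] (G : SimpleGraph V) (v : V) : Finset V :=
  univ.filter (G.Adj v)

@[simp]
theorem mem_nbhd {V : Type*} [Fintype V] {G : SimpleGraph V} {v w : V} :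
    w ∈ nbhd G v ↔ G.Adj v w := by
  simp [nbhd]

theorem ncard_neighborSet {V : Type*} [Fintype V] (G : SimpleGraph V) (v : V) :
    (G.neighborSet v).ncard = (nbhd G v).card := by
  rw [← Set.ncard_coe_finset]
  congr 1
  ext w
  simp

theorem sum_card_nbhd {V : Type*} [Fintype V] (G : SimpleGraph V) :
    ∑ v, (nbhd G v).card = 2 * G.edgeSet.ncard := by
  classical
  have h := G.sum_degrees_eq_twice_card_edges
  rw [← Set.ncard_coe_finset, SimpleGraph.coe_edgeFinset] at h
  rw [← h]
  refine sum_congr rfl fun v _ => ?_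
  rw [← SimpleGraph.card_neighborFinset_eq_degree]
  congr 1
  ext w
  simp

/-- There is an edge whose ends have degrees at least `s` and `t`, and whose ends together have
at least `s + t` neighbours. -/
def HasDoubleStar {V : Type*} [Fintype V] [DecidableEq V] (G : SimpleGraph V) (s t : ℕ) : Prop :=
  ∃ u v, G.Adj u v ∧ s ≤ (nbhd G u).card ∧ t ≤ (nbhd G v).card ∧
    s + t ≤ (nbhd G u ∪ nbhd G v).card

/-- Two finite sets whose union is large contain disjoint subsets of prescribed sizes. -/
theorem exists_disjoint_subsets_card {α : Type*} [DecidableEq α] {P Q : Finset α} {p q : ℕ}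
    (hP : p ≤ P.card) (hQ : q ≤ Q.card) (hPQ : p + q ≤ (P ∪ Q).card) :
    ∃ A B : Finset α, A ⊆ P ∧ B ⊆ Q ∧ Disjoint A B ∧ A.card = p ∧ B.card = q := by
  rcases le_total p (P \ Q).card with h | h
  · obtain ⟨A, hA, hAc⟩ := exists_subset_card_eq h
    obtain ⟨B, hB, hBc⟩ := exists_subset_card_eq hQ
    refine ⟨A, B, hA.trans sdiff_subset, hB, ?_, hAc, hBc⟩
    exact (disjoint_sdiff_self_left (x := Q) (y := P)).mono hA hB
  -- Once `A` contains `P \ Q`, the union `P ∪ Q` is covered by `A` and `Q \ A`, which leaves enough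
  -- room for `B` in `Q \ A`.
  · obtain ⟨A, hA, hAP, hAc⟩ := exists_subsuperset_card_eq sdiff_subset h hP
    have hq : q ≤ (Q \ A).card := by
      have h1 : P ∪ Q ⊆ A ∪ Q \ A := by
        intro x hx
        by_cases hxA : x ∈ A
        · simp [hxA]
        · have := @hA x
          simp only [mem_union, mem_sdiff] at *
          tauto
      have := (card_le_card h1).trans (card_union_le _ _)
      omega
    obtain ⟨B, hB, hBc⟩ := exists_subset_card_eq hq
    exact ⟨A, B, hAP, hB.trans sdiff_subset, (disjoint_sdiff (s := A) (t := Q)).mono_right hB,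
      hAc, hBc⟩

theorem hasDoubleStar_of_isContained {V : Type*} [Fintype V] [DecidableEq V] {G : SimpleGraph V}
    {s t : ℕ} {hs : 0 < s} {ht : 0 < t} (h : doubleStar s t hs ht ⊑ G) : HasDoubleStar G s t := by
  obtain ⟨f⟩ := h
  have hadj : ∀ {a b}, (doubleStar s t hs ht).Adj a b → G.Adj (f a) (f b) :=
    fun hab => f.toHom.map_adj hab
  have huv : G.Adj (f (Sum.inl ⟨0, hs⟩)) (f (Sum.inr ⟨0, ht⟩)) :=
    hadj (by simp [doubleStar, SimpleGraph.edge_adj])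
  have hl : ∀ i : Fin s, i ≠ ⟨0, hs⟩ → G.Adj (f (Sum.inl ⟨0, hs⟩)) (f (Sum.inl i)) :=
    fun i hi => hadj (by simp [doubleStar, SimpleGraph.starGraph_adj, hi.symm])
  have hr : ∀ i : Fin t, i ≠ ⟨0, ht⟩ → G.Adj (f (Sum.inr ⟨0, ht⟩)) (f (Sum.inr i)) :=
    fun i hi => hadj (by simp [doubleStar, SimpleGraph.starGraph_adj, hi.symm])
  have hinj : Function.Injective f := f.injective
  refine ⟨_, _, huv, ?_, ?_, ?_⟩
  · have h1 : ((insert (Sum.inr ⟨0, ht⟩) ((univ.erase (⟨0, hs⟩ : Fin s)).image Sum.inl)).image f)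
        ⊆ nbhd G (f (Sum.inl ⟨0, hs⟩)) := by
      intro x hx
      simp only [mem_image, mem_insert, mem_erase] at hx
      obtain ⟨y, rfl | ⟨i, hi, rfl⟩, rfl⟩ := hx
      · simpa using huv
      · simpa using hl i hi.1
    have h2 := card_le_card h1
    rw [card_image_of_injective _ hinj, card_insert_of_notMem (by simp),
      card_image_of_injective _ Sum.inl_injective, card_erase_of_mem (mem_univ _), card_univ,
      Fintype.card_fin] at h2
    omega
  · have h1 : ((insert (Sum.inl ⟨0, hs⟩) ((univ.erase (⟨0, ht⟩ : Fin t)).image Sum.inr)).image f)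
        ⊆ nbhd G (f (Sum.inr ⟨0, ht⟩)) := by
      intro x hx
      simp only [mem_image, mem_insert, mem_erase] at hx
      obtain ⟨y, rfl | ⟨i, hi, rfl⟩, rfl⟩ := hx
      · simpa using huv.symm
      · simpa using hr i hi.1
    have h2 := card_le_card h1
    rw [card_image_of_injective _ hinj, card_insert_of_notMem (by simp),
      card_image_of_injective _ Sum.inr_injective, card_erase_of_mem (mem_univ _), card_univ,
      Fintype.card_fin] at h2
    omega
  · have h1 : univ.image f ⊆ nbhd G (f (Sum.inl ⟨0, hs⟩)) ∪ nbhd G (f (Sum.inr ⟨0, ht⟩)) := by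
      intro x hx
      obtain ⟨y, -, rfl⟩ := mem_image.1 hx
      rcases y with i | i
      · by_cases hi : i = ⟨0, hs⟩
        · subst hi; simp [huv.symm]
        · simpa using Or.inl (hl i hi)
      · by_cases hi : i = ⟨0, ht⟩
        · subst hi; simp [huv]
        · simpa using Or.inr (hr i hi)
    have h2 := card_le_card h1
    rw [card_image_of_injective _ hinj, card_univ, Fintype.card_sum, Fintype.card_fin,
      Fintype.card_fin] at h2
    exact h2

/-- A finite set of size `s - 1` is enumerated, together with one more point, by `Fin s`. -/
theorem exists_injective_fin_of_card {α : Type*} {A : Finset α} {s : ℕ} (hs : 0 < s)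
    (hA : A.card + 1 = s) {u : α} (hu : u ∉ A) :
    ∃ f : Fin s → α, Function.Injective f ∧ f ⟨0, hs⟩ = u ∧ ∀ i, i ≠ ⟨0, hs⟩ → f i ∈ A := by
  obtain rfl := hA
  refine ⟨Fin.cons u fun i => (A.equivFin.symm i : α), ?_, rfl, ?_⟩
  · rw [Fin.cons_injective_iff]
    refine ⟨?_, Subtype.val_injective.comp A.equivFin.symm.injective⟩
    rintro ⟨i, hi⟩
    exact hu (hi ▸ (A.equivFin.symm i).2)
  · intro i hi
    obtain ⟨j, rfl⟩ := Fin.exists_succ_eq.2 hi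
    simp

theorem isContained_of_hasDoubleStar {V : Type*} [Fintype V] [DecidableEq V] {G : SimpleGraph V}
    {s t : ℕ} {hs : 0 < s} {ht : 0 < t} (h : HasDoubleStar G s t) : doubleStar s t hs ht ⊑ G := by
  obtain ⟨u, v, huv, hu, hv, huvc⟩ := h
  have hvu : v ∈ nbhd G u := by simpa using huv
  have huv' : u ∈ nbhd G v := by simpa using huv.symm
  have hne := huv.ne
  -- Each centre lies in the other's neighbourhood, so exactly two vertices are lost when the leaves
  -- are sought away from the centres.
  have hun : ((nbhd G u).erase v ∪ (nbhd G v).erase u).card + 2 = (nbhd G u ∪ nbhd G v).card := by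
    have h1 : (nbhd G u).erase v ∪ (nbhd G v).erase u = ((nbhd G u ∪ nbhd G v).erase u).erase v := by
      ext x
      simp only [mem_union, mem_erase, mem_nbhd]
      have h1 : G.Adj u x → x ≠ u := fun h => h.ne'
      have h2 : G.Adj v x → x ≠ v := fun h => h.ne'
      tauto
    rw [h1, card_erase_of_mem (by simp [hne.symm, huv]), card_erase_of_mem (by simp [huv.symm])]
    omega
  obtain ⟨A, B, hA, hB, hAB, hAc, hBc⟩ := exists_disjoint_subsets_card
    (P := (nbhd G u).erase v) (Q := (nbhd G v).erase u) (p := s - 1) (q := t - 1)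
    (by rw [card_erase_of_mem hvu]; omega) (by rw [card_erase_of_mem huv']; omega) (by omega)
  have huA : u ∉ A := fun h => by simpa using hA h
  have hvB : v ∉ B := fun h => by simpa using hB h
  have hvA : v ∉ A := fun h => by simpa using hA h
  have huB : u ∉ B := fun h => by simpa using hB h
  obtain ⟨f, hf, hf0, hfA⟩ := exists_injective_fin_of_card hs (by omega) huA
  obtain ⟨g, hg, hg0, hgB⟩ := exists_injective_fin_of_card ht (by omega) hvB
  have hfu : ∀ i, f i = u ∨ f i ∈ A := fun i => by
    by_cases hi : i = ⟨0, hs⟩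
    · exact Or.inl (hi ▸ hf0)
    · exact Or.inr (hfA i hi)
  have hgv : ∀ i, g i = v ∨ g i ∈ B := fun i => by
    by_cases hi : i = ⟨0, ht⟩
    · exact Or.inl (hi ▸ hg0)
    · exact Or.inr (hgB i hi)
  have hfg : ∀ i j, f i ≠ g j := by
    intro i j hij
    rcases hfu i with h | h <;> rcases hgv j with h' | h'
    · exact hne (h.symm.trans (hij.trans h'))
    · exact huB (h ▸ hij ▸ h')
    · exact hvA (h' ▸ hij ▸ h)
    · exact disjoint_left.1 hAB h (hij ▸ h')
  have hfadj : ∀ i, i ≠ ⟨0, hs⟩ → G.Adj u (f i) := fun i hi => by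
    simpa using mem_of_mem_erase (hA (hfA i hi))
  have hgadj : ∀ i, i ≠ ⟨0, ht⟩ → G.Adj v (g i) := fun i hi => by
    simpa using mem_of_mem_erase (hB (hgB i hi))
  refine ⟨⟨⟨Sum.elim f g, ?_⟩, ?_⟩⟩
  · rintro (i | i) (j | j) hij
    · simp only [doubleStar, SimpleGraph.sup_adj, SimpleGraph.sum_adj_inl,
        SimpleGraph.starGraph_adj, SimpleGraph.edge_adj, Sum.inl.injEq, reduceCtorEq, and_false,
        false_and, or_false] at hij
      obtain ⟨hij, rfl | rfl⟩ := hij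
      · simpa [hf0] using hfadj j hij.symm
      · simpa [hf0] using (hfadj i hij).symm
    · simp only [doubleStar, SimpleGraph.sup_adj, SimpleGraph.edge_adj, Sum.inl.injEq,
        Sum.inr.injEq, reduceCtorEq, and_false, or_false, SimpleGraph.sum_adj,
        false_or, ne_eq, not_false_eq_true, and_true] at hij
      simpa [hij.1, hij.2, hf0, hg0] using huv
    · simp only [doubleStar, SimpleGraph.sup_adj, SimpleGraph.edge_adj, Sum.inl.injEq,
        Sum.inr.injEq, reduceCtorEq, and_false, SimpleGraph.sum_adj,
        false_or, ne_eq, not_false_eq_true, and_true] at hij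
      simpa [hij.1, hij.2, hf0, hg0] using huv.symm
    · simp only [doubleStar, SimpleGraph.sup_adj, SimpleGraph.sum_adj_inr,
        SimpleGraph.starGraph_adj, SimpleGraph.edge_adj, Sum.inr.injEq, reduceCtorEq, and_false,
        false_and, or_false] at hij
      obtain ⟨hij, rfl | rfl⟩ := hij
      · simpa [hg0] using hgadj j hij.symm
      · simpa [hg0] using (hgadj i hij).symm
  · exact hf.sumElim hg hfg

theorem doubleStar_isContained_iff {V : Type*} [Fintype V] [DecidableEq V] {G : SimpleGraph V}
    {s t : ℕ} {hs : 0 < s} {ht : 0 < t} : doubleStar s t hs ht ⊑ G ↔ HasDoubleStar G s t :=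
  ⟨hasDoubleStar_of_isContained, isContained_of_hasDoubleStar⟩

theorem isSaturated_doubleStar_iff {V : Type*} [Fintype V] [DecidableEq V] {G : SimpleGraph V}
    {s t : ℕ} {hs : 0 < s} {ht : 0 < t} : IsSaturated (doubleStar s t hs ht) G ↔
      ¬ HasDoubleStar G s t ∧
        ∀ x y, x ≠ y → ¬ G.Adj x y → HasDoubleStar (G ⊔ SimpleGraph.edge x y) s t := by
  simp only [IsSaturated, SimpleGraph.Free, doubleStar_isContained_iff]

/-! ### Neighbourhoods after adding an edge -/

theorem sup_edge_comm {V : Type*} (G : SimpleGraph V) (x y : V) :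
    G ⊔ SimpleGraph.edge x y = G ⊔ SimpleGraph.edge y x := by
  rw [SimpleGraph.edge_comm]

theorem nbhd_sup_edge_left {V : Type*} [Fintype V] [DecidableEq V] (G : SimpleGraph V) {x y : V}
    (hxy : x ≠ y) : nbhd (G ⊔ SimpleGraph.edge x y) x = insert y (nbhd G x) := by
  ext z
  simp only [mem_nbhd, SimpleGraph.sup_adj, SimpleGraph.edge_adj, mem_insert]
  grind

theorem nbhd_sup_edge_right {V : Type*} [Fintype V] [DecidableEq V] (G : SimpleGraph V) {x y : V}
    (hxy : x ≠ y) : nbhd (G ⊔ SimpleGraph.edge x y) y = insert x (nbhd G y) := by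
  rw [sup_edge_comm, nbhd_sup_edge_left G hxy.symm]

theorem nbhd_sup_edge_of_ne {V : Type*} [Fintype V] (G : SimpleGraph V) {x y z : V}
    (hzx : z ≠ x) (hzy : z ≠ y) : nbhd (G ⊔ SimpleGraph.edge x y) z = nbhd G z := by
  ext w
  simp [SimpleGraph.sup_adj, SimpleGraph.edge_adj, hzx, hzy]

theorem adj_sup_edge_of_ne {V : Type*} {G : SimpleGraph V} {x y u v : V}
    (h : (G ⊔ SimpleGraph.edge x y).Adj u v) (hvx : v ≠ x) (hvy : v ≠ y) : G.Adj u v := by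
  simpa [SimpleGraph.sup_adj, SimpleGraph.edge_adj, hvx, hvy] using h

/-- The vertex `c` is a neighbour of `u` of degree at least `t` such that `u` and `c` together have
at least `s + t - 1` neighbours. -/
def IsGoodNbr {V : Type*} [Fintype V] [DecidableEq V] (G : SimpleGraph V) (s t : ℕ) (u c : V) :
    Prop :=
  G.Adj u c ∧ t ≤ (nbhd G c).card ∧ s + t ≤ (nbhd G u ∪ nbhd G c).card + 1

theorem card_insert_union_le {V : Type*} [DecidableEq V] (A B : Finset V) (x : V) :
    (insert x A ∪ B).card ≤ (A ∪ B).card + 1 := by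
  rw [insert_union]
  exact card_insert_le _ _

/-! ### Consequences of saturation -/

section Saturated

variable {V : Type*} [Fintype V] [DecidableEq V] {G : SimpleGraph V} {s t : ℕ}

/-- What a new double star looks like, after the addition of the edge `xy`. -/
theorem exists_center_of_hasDoubleStar_sup_edge (hG : ¬ HasDoubleStar G s t) {x y : V}
    (hxy : x ≠ y) (h : HasDoubleStar (G ⊔ SimpleGraph.edge x y) s t)
    (hx : (nbhd G x).card + 1 < t) (hy : (nbhd G y).card + 1 < t) :
    ∃ c, (G.Adj x c ∧ t ≤ (nbhd G c).card ∧ s + t ≤ (insert y (nbhd G x) ∪ nbhd G c).card) ∨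
      (G.Adj y c ∧ t ≤ (nbhd G c).card ∧ s + t ≤ (insert x (nbhd G y) ∪ nbhd G c).card) := by
  obtain ⟨u, v, huv, hu, hv, huvc⟩ := h
  have hvx : v ≠ x := by
    rintro rfl
    rw [nbhd_sup_edge_left G hxy] at hv
    have := card_insert_le y (nbhd G v)
    omega
  have hvy : v ≠ y := by
    rintro rfl
    rw [nbhd_sup_edge_right G hxy] at hv
    have := card_insert_le x (nbhd G v)
    omega
  have huv' := adj_sup_edge_of_ne huv hvx hvy
  rw [nbhd_sup_edge_of_ne G hvx hvy] at hv huvc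
  by_cases hux : u = x
  · subst hux
    rw [nbhd_sup_edge_left G hxy] at huvc
    exact ⟨v, Or.inl ⟨huv', hv, huvc⟩⟩
  by_cases huy : u = y
  · subst huy
    rw [nbhd_sup_edge_right G hxy] at huvc
    exact ⟨v, Or.inr ⟨huv', hv, huvc⟩⟩
  rw [nbhd_sup_edge_of_ne G hux huy] at hu huvc
  exact absurd ⟨u, v, huv', hu, hv, huvc⟩ hG

/-- If `x` has degree at most `s - 2`, then every vertex not adjacent to `x` has degree at least
`s - 1`, and has a neighbour of degree at least `s`. -/
theorem of_hasDoubleStar_sup_edge_of_card_lt (hst : s < t) (hG : ¬ HasDoubleStar G s t) {x y : V}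
    (hxy : x ≠ y) (h : HasDoubleStar (G ⊔ SimpleGraph.edge x y) s t)
    (hx : (nbhd G x).card + 1 < s) :
    s ≤ (nbhd G y).card + 1 ∧ ∃ z, G.Adj y z ∧ s ≤ (nbhd G z).card := by
  obtain ⟨u, v, huv, hu, hv, huvc⟩ := h
  have hlt : (nbhd (G ⊔ SimpleGraph.edge x y) x).card < s := by
    rw [nbhd_sup_edge_left G hxy]
    have := card_insert_le y (nbhd G x)
    omega
  have hux : u ≠ x := by
    rintro rfl
    omega
  have hvx : v ≠ x := by
    rintro rfl
    omega
  have hy := card_insert_le x (nbhd G y)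
  by_cases hvy : v = y
  · subst hvy
    rw [nbhd_sup_edge_right G hxy] at hv
    rw [nbhd_sup_edge_of_ne G hux huv.ne] at hu
    exact ⟨by omega, u, adj_sup_edge_of_ne huv.symm hux huv.ne, hu⟩
  by_cases huy : u = y
  · subst huy
    rw [nbhd_sup_edge_right G hxy] at hu
    rw [nbhd_sup_edge_of_ne G hvx hvy] at hv
    exact ⟨by omega, v, adj_sup_edge_of_ne huv hvx hvy, by omega⟩
  have huv' := adj_sup_edge_of_ne huv hvx hvy
  rw [nbhd_sup_edge_of_ne G hux huy] at hu huvc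
  rw [nbhd_sup_edge_of_ne G hvx hvy] at hv huvc
  exact absurd ⟨u, v, huv', hu, hv, huvc⟩ hG

/-! ### Discharging -/

variable (G s t) in
open Classical in
/-- The charge sent by a vertex `c` of degree at least `t` to a neighbour `u` of degree `s - 1`. -/
noncomputable def charge (u c : V) : ℕ :=
  if (nbhd G u).card + 1 = s ∧ IsGoodNbr G s t u c then
    if t < (nbhd G c).card ∨ ∀ c', IsGoodNbr G s t u c' → c' = c then 2 else 1
  else 0

variable (G s) in
/-- The vertices of degree `s - 1`. -/
noncomputable def lowVerts : Finset V := univ.filter fun v => (nbhd G v).card + 1 = s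

/-- Either some good neighbour pays 2, or no good neighbour is unique; then there are at least two
of them and each pays 1. -/
theorem two_le_sum_charge {u c : V} (hu : (nbhd G u).card + 1 = s) (hc : IsGoodNbr G s t u c) :
    2 ≤ ∑ c, charge G s t u c := by
  by_cases h : ∃ c, IsGoodNbr G s t u c ∧
      (t < (nbhd G c).card ∨ ∀ c', IsGoodNbr G s t u c' → c' = c)
  · obtain ⟨c, hc, h⟩ := h
    have h2 : charge G s t u c = 2 := by
      rw [charge, if_pos ⟨hu, hc⟩, if_pos h]
    exact h2 ▸ single_le_sum (f := charge G s t u) (fun _ _ => Nat.zero_le _) (mem_univ c)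
  · have h1 := h
    push Not at h1
    obtain ⟨-, c', hc', hne⟩ := h1 c hc
    have key : ∀ d, IsGoodNbr G s t u d → charge G s t u d = 1 := by
      intro d hd
      rw [charge, if_pos ⟨hu, hd⟩, if_neg fun h' => h ⟨d, hd, h'⟩]
    calc 2 = ∑ d ∈ {c', c}, charge G s t u d := by
          rw [sum_pair hne, key c' hc', key c hc]
      _ ≤ _ := sum_le_sum_of_subset (subset_univ _)

theorem sum_charge_eq_zero {c : V} (hc : (nbhd G c).card < t) :
    ∑ u, charge G s t u c = 0 := by
  refine sum_eq_zero fun u _ => ?_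
  rw [charge, if_neg]
  rintro ⟨-, -, h, -⟩
  omega

theorem sum_charge_le (c : V) :
    ∑ u, charge G s t u c ≤ 2 * (nbhd G c ∩ lowVerts G s).card := by
  rw [← sum_subset (subset_univ (nbhd G c ∩ lowVerts G s)), mul_comm, ← smul_eq_mul]
  · refine sum_le_card_nsmul _ _ _ fun u _ => ?_
    unfold charge
    split_ifs <;> omega
  · intro u _ hu
    rw [charge, if_neg]
    rintro ⟨h, h', -⟩
    exact hu (by simp [lowVerts, h, h'.symm])

/-- If `u` and `v` were adjacent, `v` would be a common neighbour of `u` and `c`, making their union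
too small for `c` to be good. If they are distinct and nonadjacent, the double star created by `uv`
has its `t`-centre at a good neighbour of `u` or `v`, that is, at `c`; but both already lie in the
neighbourhood of `c`, so the new edge leaves the union at `(s - 1) + t` at most. -/
theorem eq_of_unique_isGoodNbr (hst : s < t) (hG : ¬ HasDoubleStar G s t)
    (hsat : ∀ x y, x ≠ y → ¬ G.Adj x y → HasDoubleStar (G ⊔ SimpleGraph.edge x y) s t)
    {c u v : V} (hc : (nbhd G c).card = t)
    (hu : (nbhd G u).card + 1 = s) (hv : (nbhd G v).card + 1 = s)
    (huc : IsGoodNbr G s t u c) (hvc : IsGoodNbr G s t v c)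
    (hu1 : ∀ c', IsGoodNbr G s t u c' → c' = c) (hv1 : ∀ c', IsGoodNbr G s t v c' → c' = c) :
    u = v := by
  by_contra hne
  have hnadj : ¬ G.Adj u v := by
    intro huv
    have h1 := card_union_add_card_inter (nbhd G u) (nbhd G c)
    have h2 : 0 < (nbhd G u ∩ nbhd G c).card :=
      card_pos.2 ⟨v, by simp [huv, hvc.1.symm]⟩
    have := huc.2.2
    omega
  have key : ∀ u v : V, (nbhd G u).card + 1 = s → IsGoodNbr G s t v c →
      (∀ c', IsGoodNbr G s t u c' → c' = c) → ∀ c', G.Adj u c' → t ≤ (nbhd G c').card →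
      s + t ≤ (insert v (nbhd G u) ∪ nbhd G c').card → False := by
    intro u v hu hvc hu1 c' h1 h2 h3
    obtain rfl := hu1 c' ⟨h1, h2, h3.trans (card_insert_union_le _ _ _)⟩
    rw [insert_union, insert_eq_of_mem (by simp [hvc.1.symm])] at h3
    have := card_union_le (nbhd G u) (nbhd G c')
    omega
  obtain ⟨c', ⟨h1, h2, h3⟩ | ⟨h1, h2, h3⟩⟩ := exists_center_of_hasDoubleStar_sup_edge hG hne
    (hsat u v hne hnadj) (by omega) (by omega)
  · exact key u v hu hvc hu1 c' h1 h2 h3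
  · exact key v u hv huc hv1 c' h1 h2 h3

theorem sum_charge_le_of_card_eq (hst : s < t) (hG : ¬ HasDoubleStar G s t)
    (hsat : ∀ x y, x ≠ y → ¬ G.Adj x y → HasDoubleStar (G ⊔ SimpleGraph.edge x y) s t)
    {c : V} (hc : (nbhd G c).card = t) :
    ∑ u, charge G s t u c ≤ (nbhd G c ∩ lowVerts G s).card + 1 := by
  classical
  -- These are the only neighbours to which a vertex of degree exactly `t` pays 2.
  set U := (nbhd G c ∩ lowVerts G s).filter fun u =>
    IsGoodNbr G s t u c ∧ ∀ c', IsGoodNbr G s t u c' → c' = c with hU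
  have hU1 : U.card ≤ 1 := by
    rw [card_le_one]
    intro u hu v hv
    simp only [hU, mem_filter, mem_inter, lowVerts, mem_univ, true_and] at hu hv
    exact eq_of_unique_isGoodNbr hst hG hsat hc hu.1.2 hv.1.2 hu.2.1 hv.2.1 hu.2.2 hv.2.2
  have h1 : ∀ u, charge G s t u c ≤
      (if u ∈ nbhd G c ∩ lowVerts G s then 1 else 0) + if u ∈ U then 1 else 0 := by
    intro u
    unfold charge
    by_cases h1 : (nbhd G u).card + 1 = s ∧ IsGoodNbr G s t u c
    · have h3 : u ∈ nbhd G c ∩ lowVerts G s := by simp [lowVerts, h1.1, h1.2.1.symm]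
      rw [if_pos h1, if_pos h3]
      split_ifs with h2 h4 h4
      · exact le_rfl
      · exact absurd (mem_filter.2 ⟨h3, h1.2, h2.resolve_left (by omega)⟩) h4
      all_goals omega
    · rw [if_neg h1]
      exact Nat.zero_le _
  calc ∑ u, charge G s t u c
      ≤ ∑ u, ((if u ∈ nbhd G c ∩ lowVerts G s then 1 else 0) + if u ∈ U then 1 else 0) :=
        sum_le_sum fun u _ => h1 u
    _ = (nbhd G c ∩ lowVerts G s).card + U.card := by
        rw [sum_add_distrib, ← card_filter, ← card_filter, filter_univ_mem, filter_univ_mem]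
    _ ≤ _ := by omega

variable (G s t) in
/-- The excess of the degree of `v` over the average `s (t + 1) / (t + 2)`, scaled by `t + 2`. -/
noncomputable def excess (v : V) : ℤ := (t + 2) * (nbhd G v).card - s * (t + 1)

variable (G s t) in
/-- Twice the excess of `v`, after the charges have been moved. -/
noncomputable def finalCharge (v : V) : ℤ :=
  2 * excess G s t v - (t + 2 - s) * (∑ u, charge G s t u v : ℕ) +
    (t + 2 - s) * (∑ c, charge G s t v c : ℕ)

theorem sum_finalCharge : ∑ v, finalCharge G s t v = 2 * ∑ v, excess G s t v := by
  simp only [finalCharge, sum_add_distrib, sum_sub_distrib, ← mul_sum, Nat.cast_sum]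
  rw [sum_comm]
  ring

omit [DecidableEq V] in
theorem sum_excess : ∑ v, excess G s t v =
    (t + 2) * (2 * G.edgeSet.ncard) - s * (t + 1) * Fintype.card V := by
  have h := sum_card_nbhd G
  zify at h
  simp only [excess, sum_sub_distrib, ← mul_sum, h, sum_const, card_univ, nsmul_eq_mul]
  ring

/-- Good neighbours have degree at least `t`, so smaller vertices only receive. -/
theorem excess_le_finalCharge_of_card_lt (hst : s < t) {v : V} (hv : (nbhd G v).card < t) :
    2 * excess G s t v ≤ finalCharge G s t v := by
  rw [finalCharge, sum_charge_eq_zero hv]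
  have : (0 : ℤ) ≤ (t + 2 - s) * (∑ c, charge G s t v c : ℕ) :=
    mul_nonneg (by omega) (by positivity)
  push_cast at this ⊢
  linarith

theorem finalCharge_nonneg_of_isGoodNbr (hst : s < t) {u c : V} (hu : (nbhd G u).card + 1 = s)
    (hc : IsGoodNbr G s t u c) : 0 ≤ finalCharge G s t u := by
  rw [finalCharge, sum_charge_eq_zero (by omega)]
  have h := two_le_sum_charge hu hc
  zify at h hu hst
  push_cast
  have : ((t : ℤ) + 2 - s) * 2 ≤ (t + 2 - s) * ∑ c, (charge G s t u c : ℤ) :=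
    mul_le_mul_of_nonneg_left h (by linarith)
  have h' : ((nbhd G u).card : ℤ) = s - 1 := by linarith
  rw [excess, h']
  linarith

theorem neg_le_finalCharge_of_low (hst : s < t) {u : V} (hu : (nbhd G u).card + 1 = s) :
    -(2 * ((t : ℤ) + 2 - s)) ≤ finalCharge G s t u := by
  refine le_trans ?_ (excess_le_finalCharge_of_card_lt hst (by omega))
  zify at hu
  have h' : ((nbhd G u).card : ℤ) = s - 1 := by linarith
  rw [excess, h']
  linarith

theorem neg_le_finalCharge_of_card_lt (hst : s < t) {u : V} (hu : (nbhd G u).card < t) :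
    -(2 * ((s : ℤ) * (t + 1))) ≤ finalCharge G s t u := by
  refine le_trans ?_ (excess_le_finalCharge_of_card_lt hst hu)
  rw [excess]
  have : (0 : ℤ) ≤ (t + 2) * (nbhd G u).card := by positivity
  linarith

theorem two_mul_le_finalCharge_of_mid (hst : s < t) {u : V} (hu : s ≤ (nbhd G u).card)
    (hu' : (nbhd G u).card < t) : 2 * (s : ℤ) ≤ finalCharge G s t u := by
  refine le_trans ?_ (excess_le_finalCharge_of_card_lt hst hu')
  rw [excess]
  zify at hu
  have : ((t : ℤ) + 2) * s ≤ (t + 2) * (nbhd G u).card :=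
    mul_le_mul_of_nonneg_left hu (by positivity)
  linarith

/-- The final charge of a vertex of large degree with at most `l` neighbours of degree `s - 1`. -/
theorem finalCharge_big (hst : s < t) (hG : ¬ HasDoubleStar G s t)
    (hsat : ∀ x y, x ≠ y → ¬ G.Adj x y → HasDoubleStar (G ⊔ SimpleGraph.edge x y) s t)
    {c : V} {l : ℕ} (hl : (nbhd G c ∩ lowVerts G s).card ≤ l) :
    ((nbhd G c).card = t → 2 * (((t : ℤ) + 2 - s) * t - s) - (t + 2 - s) * (l + 1)
        ≤ finalCharge G s t c) ∧
      2 * ((t + 2 - s) * (nbhd G c).card + s * ((nbhd G c).card - (t + 1)))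
        - 2 * (t + 2 - s) * l ≤ finalCharge G s t c := by
  have ha : (0 : ℤ) ≤ t + 2 - s := by omega
  have h0 : (0 : ℤ) ≤ (t + 2 - s) * (∑ d, charge G s t c d : ℕ) :=
    mul_nonneg ha (by positivity)
  unfold finalCharge excess
  refine ⟨fun hct => ?_, ?_⟩
  · have h1 : (∑ u, charge G s t u c) ≤ l + 1 :=
      (sum_charge_le_of_card_eq hst hG hsat hct).trans (by omega)
    have h2 : ((t : ℤ) + 2 - s) * (∑ u, charge G s t u c : ℕ) ≤ (t + 2 - s) * (l + 1) :=
      mul_le_mul_of_nonneg_left (by exact_mod_cast h1) ha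
    rw [hct]
    linarith
  · have h1 : (∑ u, charge G s t u c) ≤ 2 * l := (sum_charge_le c).trans (by omega)
    have h2 : ((t : ℤ) + 2 - s) * (∑ u, charge G s t u c : ℕ) ≤ (t + 2 - s) * (2 * l) :=
      mul_le_mul_of_nonneg_left (by exact_mod_cast h1) ha
    linarith

/-- For degree `d > t` the surplus after paying 2 to every neighbour is `2s(d - (t + 1))`, which
vanishes at the centres of the extremal stars. -/
theorem card_sub_le_mul_finalCharge (hs : 0 < s) (hst : s < t) (hG : ¬ HasDoubleStar G s t)
    (hsat : ∀ x y, x ≠ y → ¬ G.Adj x y → HasDoubleStar (G ⊔ SimpleGraph.edge x y) s t)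
    {c : V} (hc : t ≤ (nbhd G c).card) :
    0 ≤ finalCharge G s t c ∧
      ((nbhd G c).card : ℤ) - (t + 1) ≤ (t + 1) * finalCharge G s t c := by
  obtain ⟨h1, h2⟩ := finalCharge_big hst hG hsat (card_le_card inter_subset_left)
  rcases hc.eq_or_lt with h | h
  · have h3 := h1 h.symm
    rw [← h] at h3 ⊢
    -- The bound is `(t + 2 - s)(t - 1) - 2s`, where `t + 2 - s ≥ 3` and `t - 1 ≥ s`.
    have h4 : 0 ≤ finalCharge G s t c := by
      zify at hst hs
      nlinarith
    refine ⟨h4, ?_⟩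
    have : 0 ≤ ((t : ℤ) + 1) * finalCharge G s t c := by positivity
    linarith
  · zify at h hs
    have h4 : ((nbhd G c).card : ℤ) - (t + 1) ≤ finalCharge G s t c := by
      nlinarith
    refine ⟨by linarith, ?_⟩
    nlinarith

/-- The neighbour `z` is not low and is never paid. The amount saved makes the final charge at least
1 for degree `t` and at least `d - t` for degree `d > t`; the factor `t + 1` turns this into at
least the degree. -/
theorem card_le_mul_finalCharge (hs : 0 < s) (hst : s < t) (hG : ¬ HasDoubleStar G s t)
    (hsat : ∀ x y, x ≠ y → ¬ G.Adj x y → HasDoubleStar (G ⊔ SimpleGraph.edge x y) s t)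
    {c z : V} (hc : t ≤ (nbhd G c).card) (hcz : G.Adj c z) (hz : s ≤ (nbhd G z).card) :
    ((nbhd G c).card : ℤ) ≤ (t + 1) * finalCharge G s t c := by
  have hl : (nbhd G c ∩ lowVerts G s).card ≤ (nbhd G c).card - 1 := by
    rw [← card_erase_of_mem (a := z) (by simpa using hcz)]
    refine card_le_card fun v hv => ?_
    simp only [mem_inter, lowVerts, mem_filter, mem_univ, true_and] at hv
    refine mem_erase.2 ⟨?_, hv.1⟩
    rintro rfl
    omega
  obtain ⟨h1, h2⟩ := finalCharge_big hst hG hsat hl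
  have h3 : (((nbhd G c).card - 1 : ℕ) : ℤ) = (nbhd G c).card - 1 := by omega
  rw [h3] at h1 h2
  rcases hc.eq_or_lt with h | h
  · have h3 := h1 h.symm
    rw [← h] at h3 ⊢
    zify at hst hs
    have h4 : 1 ≤ finalCharge G s t c := by nlinarith
    nlinarith
  · zify at h hs hst
    have h4 : ((nbhd G c).card : ℤ) - (t + 1) + 1 ≤ finalCharge G s t c := by
      nlinarith
    nlinarith

variable (G s t) in
open Classical in
/-- The vertices of degree `s - 1` without good neighbours. -/
noncomputable def poorVerts : Finset V :=
  univ.filter fun v => (nbhd G v).card + 1 = s ∧ ∀ c, ¬ IsGoodNbr G s t v c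

/-- Poor vertices are pairwise adjacent, since joining two of them would expose a good neighbour of
one. They thus lie in the closed neighbourhood of any one of them, which has `s` vertices. -/
theorem card_poorVerts_le (hst : s < t) (hG : ¬ HasDoubleStar G s t)
    (hsat : ∀ x y, x ≠ y → ¬ G.Adj x y → HasDoubleStar (G ⊔ SimpleGraph.edge x y) s t) :
    (poorVerts G s t).card ≤ s := by
  rcases (poorVerts G s t).eq_empty_or_nonempty with h | ⟨u, hu⟩
  · simp [h]
  have hsub : poorVerts G s t ⊆ insert u (nbhd G u) := by
    intro v hv
    by_contra hnot
    simp only [mem_insert, mem_nbhd, not_or] at hnot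
    simp only [poorVerts, mem_filter, mem_univ, true_and] at hu hv
    obtain ⟨c, ⟨h1, h2, h3⟩ | ⟨h1, h2, h3⟩⟩ := exists_center_of_hasDoubleStar_sup_edge hG
      (Ne.symm hnot.1) (hsat u v (Ne.symm hnot.1) hnot.2) (by omega) (by omega)
    · exact hu.2 c ⟨h1, h2, h3.trans (card_insert_union_le _ _ _)⟩
    · exact hv.2 c ⟨h1, h2, h3.trans (card_insert_union_le _ _ _)⟩
  have h1 := card_le_card hsub
  have h2 := card_insert_le u (nbhd G u)
  have h3 : (nbhd G u).card + 1 = s := by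
    simp only [poorVerts, mem_filter, mem_univ, true_and] at hu
    exact hu.1
  omega

/-- The lower bound on the number of edges, if all degrees are at least `s - 1`. -/
theorem neg_le_sum_excess (hs : 0 < s) (hst : s < t) (hG : ¬ HasDoubleStar G s t)
    (hsat : ∀ x y, x ≠ y → ¬ G.Adj x y → HasDoubleStar (G ⊔ SimpleGraph.edge x y) s t)
    (hdeg : ∀ v, s ≤ (nbhd G v).card + 1) :
    -((s : ℤ) * (t + 2 - s)) ≤ ∑ v, excess G s t v := by
  have h1 : ∀ v, (if v ∈ poorVerts G s t then -(2 * ((t : ℤ) + 2 - s)) else 0)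
      ≤ finalCharge G s t v := by
    intro v
    split_ifs with h
    · simp only [poorVerts, mem_filter, mem_univ, true_and] at h
      exact neg_le_finalCharge_of_low hst h.1
    · rcases (hdeg v).eq_or_lt with hv | hv
      · simp only [poorVerts, mem_filter, mem_univ, true_and, hv.symm] at h
        push Not at h
        obtain ⟨c, hc⟩ := h
        exact finalCharge_nonneg_of_isGoodNbr hst hv.symm hc
      · rcases lt_or_ge (nbhd G v).card t with hvt | hvt
        · exact le_trans (by positivity) (two_mul_le_finalCharge_of_mid hst (by omega) hvt)
        · exact (card_sub_le_mul_finalCharge hs hst hG hsat hvt).1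
  have h2 := sum_le_sum fun v (_ : v ∈ univ) => h1 v
  rw [sum_finalCharge, sum_ite_mem, univ_inter, sum_const, nsmul_eq_mul] at h2
  have h3 : ((poorVerts G s t).card : ℤ) * (t + 2 - s) ≤ s * (t + 2 - s) :=
    mul_le_mul_of_nonneg_right (by exact_mod_cast card_poorVerts_le hst hG hsat) (by omega)
  linarith

/-- If some degree is less than `s - 1`, the excess grows linearly with the number of vertices. -/
theorem card_le_sum_excess (hs : 0 < s) (hst : s < t) (hG : ¬ HasDoubleStar G s t)
    (hsat : ∀ x y, x ≠ y → ¬ G.Adj x y → HasDoubleStar (G ⊔ SimpleGraph.edge x y) s t)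
    {x : V} (hx : (nbhd G x).card + 1 < s) :
    (Fintype.card V : ℤ) ≤ 4 * (t + 1) * ∑ v, excess G s t v +
      (8 * s ^ 2 * (t + 1) ^ 2 + 2 * s) := by
  set Y := poorVerts G s t ∪ insert x (nbhd G x) with hY
  set M := univ.filter (fun v => s ≤ (nbhd G v).card ∧ (nbhd G v).card < t) with hM
  set B := univ.filter (fun v => t ≤ (nbhd G v).card) with hB
  have hYc : Y.card ≤ 2 * s := by
    -- `Y` collects the exceptional vertices: the poor ones, and those for which saturation at `x`
    -- says nothing.
    have h1 : Y.card ≤ _ := card_union_le (poorVerts G s t) (insert x (nbhd G x))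
    have h2 := card_poorVerts_le hst hG hsat
    have h3 := card_insert_le x (nbhd G x)
    omega
  have hfar : ∀ y, y ∉ Y → s ≤ (nbhd G y).card + 1 ∧ ∃ z, G.Adj y z ∧ s ≤ (nbhd G z).card := by
    intro y hy
    simp only [hY, mem_union, mem_insert, mem_nbhd, not_or] at hy
    exact of_hasDoubleStar_sup_edge_of_card_lt hst hG (Ne.symm hy.2.1)
      (hsat x y (Ne.symm hy.2.1) hy.2.2) hx
  have hlow : ∀ y, y ∉ Y → (nbhd G y).card + 1 = s → ∃ c, IsGoodNbr G s t y c := by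
    intro y hy hys
    by_contra hno
    refine hy (mem_union_left _ ?_)
    simp only [poorVerts, mem_filter, mem_univ, true_and]
    exact ⟨hys, fun c hc => hno ⟨c, hc⟩⟩
  have hcover : (univ : Finset V) ⊆ Y ∪ M ∪ B ∪ B.biUnion (nbhd G) := by
    intro y _
    by_cases hy : y ∈ Y
    · simp [hy]
    have h1 := (hfar y hy).1
    rcases h1.eq_or_lt with h | h
    · obtain ⟨c, hc⟩ := hlow y hy h.symm
      refine mem_union_right _ (mem_biUnion.2 ⟨c, ?_, ?_⟩)
      · simpa [hB] using hc.2.1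
      · simpa using hc.1.symm
    · rcases lt_or_ge (nbhd G y).card t with h' | h'
      · have : y ∈ M := by simp only [hM, mem_filter, mem_univ, true_and]; omega
        simp [this]
      · have : y ∈ B := by simpa [hB] using h'
        simp [this]
  have hBc : B.card ≤ ∑ c ∈ B, (nbhd G c).card := by
    rw [card_eq_sum_ones]
    refine sum_le_sum fun c hc => ?_
    simp only [hB, mem_filter, mem_univ, true_and] at hc
    omega
  have hn : Fintype.card V ≤ 2 * s + M.card + 2 * ∑ c ∈ B, (nbhd G c).card := by
    have h1 := card_le_card hcover
    have h2 := card_union_le (Y ∪ M ∪ B) (B.biUnion (nbhd G))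
    have h3 := card_union_le (Y ∪ M) B
    have h4 := card_union_le Y M
    have h5 : (B.biUnion (nbhd G)).card ≤ ∑ c ∈ B, (nbhd G c).card := card_biUnion_le
    rw [card_univ] at h1
    omega
  -- The penalty on `Y` is `t + 1` times the worst deficit `2s(t + 1)` of a vertex of degree below
  -- `t`; it also absorbs the loss of `t + 1` for large vertices in `Y`.
  have hpt : ∀ v, (if v ∈ M then (1 : ℤ) else 0) + (if v ∈ B then ((nbhd G v).card : ℤ) else 0)
      - (if v ∈ Y then 2 * ((s : ℤ) * (t + 1) ^ 2) else 0) ≤ (t + 1) * finalCharge G s t v := by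
    intro v
    have hs' : (1 : ℤ) ≤ s := by exact_mod_cast hs
    have ht' : (1 : ℤ) ≤ t + 1 := by omega
    have hY0 : (0 : ℤ) ≤ if v ∈ Y then 2 * ((s : ℤ) * (t + 1) ^ 2) else 0 := by
      split_ifs <;> positivity
    rcases lt_or_ge (nbhd G v).card t with hvt | hvt
    · have hvB : v ∉ B := by simpa [hB] using hvt
      rw [if_neg hvB]
      by_cases hvs : s ≤ (nbhd G v).card
      · have h1 := two_mul_le_finalCharge_of_mid hst hvs hvt
        have hvM : v ∈ M := by simp [hM, hvs, hvt]
        rw [if_pos hvM]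
        nlinarith
      · have hvM : v ∉ M := by simp [hM, hvs]
        rw [if_neg hvM]
        by_cases hvY : v ∈ Y
        · rw [if_pos hvY]
          have h1 := neg_le_finalCharge_of_card_lt hst hvt
          nlinarith
        · obtain ⟨c, hc⟩ := hlow v hvY (by have := (hfar v hvY).1; omega)
          have h1 := finalCharge_nonneg_of_isGoodNbr hst
            (by have := (hfar v hvY).1; omega) hc
          have : 0 ≤ ((t : ℤ) + 1) * finalCharge G s t v := by positivity
          linarith
    · have hvB : v ∈ B := by simpa [hB] using hvt
      have hvM : v ∉ M := by simp [hM, hvt]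
      rw [if_pos hvB, if_neg hvM]
      by_cases hvY : v ∈ Y
      · rw [if_pos hvY]
        have h1 := (card_sub_le_mul_finalCharge hs hst hG hsat hvt).2
        nlinarith
      · obtain ⟨-, z, hvz, hz⟩ := hfar v hvY
        have h1 := card_le_mul_finalCharge hs hst hG hsat hvt hvz hz
        linarith
  have hsum := sum_le_sum fun v (_ : v ∈ univ) => hpt v
  rw [← mul_sum, sum_finalCharge, sum_sub_distrib, sum_add_distrib, sum_ite_mem, sum_ite_mem,
    sum_ite_mem, univ_inter, univ_inter, univ_inter, sum_const, sum_const, nsmul_eq_mul,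
    nsmul_eq_mul] at hsum
  zify at hn hYc
  have hYs : (Y.card : ℤ) * (2 * (s * (t + 1) ^ 2)) ≤ 2 * s * (2 * (s * (t + 1) ^ 2)) :=
    mul_le_mul_of_nonneg_right hYc (by positivity)
  have hM0 : (0 : ℤ) ≤ M.card := by positivity
  nlinarith

end Saturated

/-! ### The extremal graph -/

section Construction

/-- The circulant bipartite relation in which every element has `d` partners. -/
def circRel {q : ℕ} [NeZero q] (d : ℕ) (i j : Fin q) : Prop := ((j - i : Fin q) : ℕ) < d

open Classical in
theorem card_circRel_right {q : ℕ} [NeZero q] {d : ℕ} (hd : d ≤ q) (i : Fin q) :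
    (univ.filter fun j => circRel d i j).card = d := by
  have h : (univ.filter fun j => circRel d i j) =
      (univ.filter fun k : Fin q => (k : ℕ) < d).map (Equiv.addRight i).toEmbedding := by
    ext j
    simp [circRel, sub_eq_add_neg]
  rw [h, card_map, Fin.card_filter_val_lt]
  omega

open Classical in
theorem card_circRel_left {q : ℕ} [NeZero q] {d : ℕ} (hd : d ≤ q) (j : Fin q) :
    (univ.filter fun i => circRel d i j).card = d := by
  have h : (univ.filter fun i => circRel d i j) =
      (univ.filter fun k : Fin q => (k : ℕ) < d).map (Equiv.subLeft j).toEmbedding := by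
    ext i
    simp only [circRel, mem_filter, mem_univ, true_and, mem_map_equiv]
    simp [Equiv.subLeft, sub_eq_add_neg, add_comm]
  rw [h, card_map, Fin.card_filter_val_lt]
  omega

/-- Vertices of the extremal graph: a clique, the centres of stars, and the leaves of stars. -/
abbrev StarVert (s t m : ℕ) : Type := Fin s ⊕ ((Fin m × Bool) ⊕ ((Fin m × Bool) × Fin (t + 1)))

/-- Adjacency of leaves: the leaves of paired stars span a regular bipartite graph. -/
def leafAdj (s t m : ℕ) (x y : (Fin m × Bool) × Fin (t + 1)) : Prop :=
  x.1.1 = y.1.1 ∧ ((x.1.2 = false ∧ y.1.2 = true ∧ circRel (s - 2) x.2 y.2) ∨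
    (x.1.2 = true ∧ y.1.2 = false ∧ circRel (s - 2) y.2 x.2))

/-- Adjacency in the extremal graph. -/
def starAdj (s t m : ℕ) : StarVert s t m → StarVert s t m → Prop
  | .inl a, .inl b => a ≠ b
  | .inr (.inl c), .inr (.inr x) => x.1 = c
  | .inr (.inr x), .inr (.inl c) => x.1 = c
  | .inr (.inr x), .inr (.inr y) => leafAdj s t m x y
  | _, _ => False

/-- The disjoint union of a clique of order `s` and of `2 m` stars with `t + 1` leaves, with
regular bipartite graphs added between the leaves of paired stars. -/
def starUnion (s t m : ℕ) : SimpleGraph (StarVert s t m) where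
  Adj := starAdj s t m
  symm := ⟨by
    rintro (a | a | a) (b | b | b) h <;> simp only [starAdj] at h ⊢
    · exact h.symm
    · exact h
    · exact h
    · obtain ⟨h1, h2⟩ := h
      refine ⟨h1.symm, ?_⟩
      tauto⟩
  loopless := ⟨by
    rintro (a | a | a) h <;> simp only [starAdj, leafAdj] at h
    · exact h rfl
    · obtain ⟨-, ⟨h1, h2, -⟩ | ⟨h1, h2, -⟩⟩ := h <;> simp [h1] at h2⟩

variable {s t m : ℕ}

theorem card_starVert : Fintype.card (StarVert s t m) = s + 2 * m * (t + 2) := by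
  simp only [StarVert, Fintype.card_sum, Fintype.card_prod, Fintype.card_fin, Fintype.card_bool]
  ring

theorem card_nbhd_clique (a : Fin s) : (nbhd (starUnion s t m) (.inl a)).card = s - 1 := by
  have h : nbhd (starUnion s t m) (.inl a) = (univ.erase a).map Function.Embedding.inl := by
    ext (b | b | b) <;> simp [starUnion, starAdj, eq_comm]
  rw [h, card_map, card_erase_of_mem (mem_univ _), card_univ, Fintype.card_fin]

theorem card_nbhd_center (c : Fin m × Bool) :
    (nbhd (starUnion s t m) (.inr (.inl c))).card = t + 1 := by
  have h : nbhd (starUnion s t m) (.inr (.inl c)) =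
      univ.image fun j : Fin (t + 1) => (.inr (.inr (c, j)) : StarVert s t m) := by
    ext (b | b | ⟨b, j⟩) <;> simp [starUnion, starAdj, eq_comm]
  rw [h, card_image_of_injective, card_univ, Fintype.card_fin]
  intro i j hij
  simpa using hij

theorem card_nbhd_leaf (hs : 2 ≤ s) (hst : s < t) (x : (Fin m × Bool) × Fin (t + 1)) :
    (nbhd (starUnion s t m) (.inr (.inr x))).card = s - 1 := by
  classical
  obtain ⟨⟨i, b⟩, j⟩ := x
  have hd : s - 2 ≤ t + 1 := by omega
  have key : ∀ (b' : Bool) (A : Finset (Fin (t + 1))), A.card = s - 2 →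
      (insert (.inr (.inl (i, b)) : StarVert s t m)
        (A.image fun k => (.inr (.inr ((i, b'), k)) : StarVert s t m))).card = s - 1 := by
    intro b' A hA
    rw [card_insert_of_notMem (by simp), card_image_of_injective, hA]
    · omega
    · intro k l hkl
      simpa using hkl
  cases b
  · rw [← key true _ (card_circRel_right hd j)]
    congr 1
    ext (y | y | ⟨⟨y, b⟩, k⟩) <;> simp [starUnion, starAdj, leafAdj, eq_comm]
    tauto
  · rw [← key false _ (card_circRel_left hd j)]
    congr 1
    ext (y | y | ⟨⟨y, b⟩, k⟩) <;> simp [starUnion, starAdj, leafAdj, eq_comm]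
    tauto

/-- This is why the stars are paired: a leaf is joined only to leaves of the partner star, so no
triangle passes through a centre. -/
theorem disjoint_nbhd_leaf_center (x : (Fin m × Bool) × Fin (t + 1)) :
    Disjoint (nbhd (starUnion s t m) (.inr (.inr x)))
      (nbhd (starUnion s t m) (.inr (.inl x.1))) := by
  rw [disjoint_left]
  rintro (y | y | y) h1 h2 <;> simp only [mem_nbhd, starUnion, starAdj] at h1 h2
  obtain ⟨-, ⟨h3, h4, -⟩ | ⟨h3, h4, -⟩⟩ := h1 <;> simp [h2, h3] at h4

/-! ### Saturation of the extremal graph and its extensions -/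

variable {V : Type*} [Fintype V] [DecidableEq V] {G : SimpleGraph V}

theorem image_nbhd_subset {W : Type*} [Fintype W] {H : SimpleGraph W} {f : W → V}
    (hf : ∀ a b, H.Adj a b → G.Adj (f a) (f b)) (a : W) :
    (nbhd H a).image f ⊆ nbhd G (f a) := by
  intro x hx
  obtain ⟨b, hb, rfl⟩ := mem_image.1 hx
  exact mem_nbhd.2 (hf a b (mem_nbhd.1 hb))

/-- A copy of the extremal graph in which a leaf gets a new neighbour yields a double star. -/
theorem hasDoubleStar_of_leaf (hs : 2 ≤ s) (hst : s < t) {f : StarVert s t m → V}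
    (hinj : Function.Injective f) (hf : ∀ a b, (starUnion s t m).Adj a b → G.Adj (f a) (f b))
    {x : (Fin m × Bool) × Fin (t + 1)} {y : V} (hy : G.Adj (f (.inr (.inr x))) y)
    (hy' : y ∉ (nbhd (starUnion s t m) (.inr (.inr x))).image f) : HasDoubleStar G s t := by
  have h1 := image_nbhd_subset hf (.inr (.inr x))
  have h2 := image_nbhd_subset hf (.inr (.inl x.1))
  have hc1 := card_nbhd_leaf hs hst x
  have hc2 := card_nbhd_center (s := s) (t := t) x.1
  refine ⟨f (.inr (.inr x)), f (.inr (.inl x.1)), hf _ _ rfl, ?_, ?_, ?_⟩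
  · have h3 := card_le_card (insert_subset (mem_nbhd.2 hy) h1)
    rw [card_insert_of_notMem hy', card_image_of_injective _ hinj] at h3
    omega
  · have h3 := card_le_card h2
    rw [card_image_of_injective _ hinj] at h3
    omega
  · have h3 := card_le_card (union_subset_union h1 h2)
    rw [← image_union, card_image_of_injective _ hinj,
      card_union_of_disjoint (disjoint_nbhd_leaf_center x)] at h3
    omega

/-- A copy of the extremal graph in which a centre gets a new neighbour of degree at least `s`,
not adjacent to its leaves, yields a double star. -/
theorem hasDoubleStar_of_center {f : StarVert s t m → V}
    (hinj : Function.Injective f) (hf : ∀ a b, (starUnion s t m).Adj a b → G.Adj (f a) (f b))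
    {c : Fin m × Bool} {y : V} (hy : G.Adj y (f (.inr (.inl c)))) (hys : s ≤ (nbhd G y).card)
    (hdis : ∀ j, ¬ G.Adj y (f (.inr (.inr (c, j))))) : HasDoubleStar G s t := by
  have h2 := image_nbhd_subset hf (.inr (.inl c))
  have hc2 := card_nbhd_center (s := s) (t := t) c
  have h3 := card_le_card h2
  rw [card_image_of_injective _ hinj] at h3
  refine ⟨y, _, hy, hys, by omega, ?_⟩
  have h4 := card_le_card (union_subset_union (Subset.refl (nbhd G y)) h2)
  rw [card_union_of_disjoint, card_image_of_injective _ hinj] at h4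
  · omega
  · rw [disjoint_right]
    intro z hz
    obtain ⟨w, hw, rfl⟩ := mem_image.1 hz
    rcases w with w | w | ⟨w, j⟩ <;> simp only [mem_nbhd, starUnion, starAdj] at hw
    subst hw
    simpa using hdis j

/-- A new edge at a leaf raises its degree to `s`, all that was missing for a double star with its
centre. Otherwise the edge joins a centre to a clique vertex or to another centre, which then has
degree at least `s` and no neighbour among the leaves of the first centre. -/
theorem hasDoubleStar_starUnion_sup_edge (hs : 2 ≤ s) (hst : s < t) {x y : StarVert s t m}
    (hxy : x ≠ y) (hadj : ¬ (starUnion s t m).Adj x y) :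
    HasDoubleStar (starUnion s t m ⊔ SimpleGraph.edge x y) s t := by
  have hle : ∀ {x y : StarVert s t m} (a b), (starUnion s t m).Adj a b →
      (starUnion s t m ⊔ SimpleGraph.edge x y).Adj (id a) (id b) := fun a b h => Or.inl h
  have hnew : ∀ {x y : StarVert s t m}, x ≠ y →
      (starUnion s t m ⊔ SimpleGraph.edge x y).Adj x y := fun h =>
    Or.inr (by simp [SimpleGraph.edge_adj, h])
  have hleaf : ∀ z (y : StarVert s t m), .inr (.inr z) ≠ y →
      ¬ (starUnion s t m).Adj (.inr (.inr z)) y →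
      HasDoubleStar (starUnion s t m ⊔ SimpleGraph.edge (.inr (.inr z)) y) s t :=
    fun z y hzy hadj => hasDoubleStar_of_leaf hs hst Function.injective_id hle (x := z) (y := y)
      (hnew hzy) (by simpa using hadj)
  have hcenter : ∀ c (y : StarVert s t m), y ≠ .inr (.inl c) →
      s ≤ (nbhd (starUnion s t m) y).card + 1 → ¬ (starUnion s t m).Adj y (.inr (.inl c)) →
      (∀ j, ¬ (starUnion s t m).Adj y (.inr (.inr (c, j)))) →
      (∀ z, y ≠ .inr (.inr z)) →
      HasDoubleStar (starUnion s t m ⊔ SimpleGraph.edge y (.inr (.inl c))) s t := by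
    intro c y hy hys hadj hj hz
    refine hasDoubleStar_of_center Function.injective_id hle (c := c) (y := y) (hnew hy) ?_ ?_
    · rw [nbhd_sup_edge_left _ hy, card_insert_of_notMem (by simpa using hadj)]
      exact hys
    · intro j h
      rcases h with h | h
      · exact hj j h
      · simp [SimpleGraph.edge_adj] at h
        exact hz _ h.1.2.symm
  rcases x with a | c | z
  · rcases y with b | d | w
    · exact absurd (fun h => hxy (congrArg _ h)) hadj
    · exact hcenter d _ hxy (by rw [card_nbhd_clique]; omega) id (fun _ => id) (by simp)
    · rw [sup_edge_comm]
      exact hleaf w _ hxy.symm id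
  · rcases y with b | d | w
    · rw [sup_edge_comm]
      exact hcenter c _ hxy.symm (by rw [card_nbhd_clique]; omega) id (fun _ => id) (by simp)
    · refine hcenter d _ hxy (by rw [card_nbhd_center]; omega) id (fun j h => hxy ?_) (by simp)
      simp only [starUnion, starAdj] at h
      rw [h]
    · rw [sup_edge_comm]
      exact hleaf w _ hxy.symm fun h => hadj h.symm
  · exact hleaf z _ hxy hadj

/-- Only the star centres have degree at least `s`, and no two of them are adjacent. -/
theorem not_hasDoubleStar_map_starUnion (hs : 2 ≤ s) (hst : s < t) (f : StarVert s t m ↪ V) :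
    ¬ HasDoubleStar ((starUnion s t m).map f) s t := by
  rintro ⟨u, v, huv, hu, hv, -⟩
  rw [SimpleGraph.map_adj] at huv
  obtain ⟨a, b, hab, rfl, rfl⟩ := huv
  have hcard : ∀ a, (nbhd ((starUnion s t m).map f) (f a)).card
      = (nbhd (starUnion s t m) a).card := by
    intro a
    rw [← card_map f]
    congr 1
    ext z
    simp only [mem_nbhd, SimpleGraph.map_adj, mem_map]
    constructor
    · rintro ⟨a', b', h, ha, rfl⟩
      exact ⟨b', f.injective ha ▸ h, rfl⟩
    · rintro ⟨b', h, rfl⟩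
      exact ⟨a, b', h, rfl, rfl⟩
  rw [hcard] at hu hv
  rcases b with b | b | b
  · rw [card_nbhd_clique] at hv; omega
  · rcases a with a | a | a
    · exact hab
    · exact hab
    · rw [card_nbhd_leaf hs hst] at hu; omega
  · rw [card_nbhd_leaf hs hst] at hv; omega

theorem sum_card_nbhd_starUnion (hs : 2 ≤ s) (hst : s < t) :
    ∑ a, (nbhd (starUnion s t m) a).card = s * (s - 1) + 2 * m * (s * (t + 1)) := by
  obtain ⟨k, rfl⟩ := Nat.exists_eq_add_of_le hs
  simp only [Fintype.sum_sum_type, card_nbhd_clique, card_nbhd_center, card_nbhd_leaf hs hst,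
    sum_const, card_univ, Fintype.card_prod, Fintype.card_fin, Fintype.card_bool, smul_eq_mul]
  have : 2 + k - 1 = k + 1 := by omega
  rw [this]
  ring

/-- Extending a copy of the extremal graph to a saturated graph, every vertex outside the copy
has bounded degree. -/
theorem card_nbhd_le_of_notMem_range (hs : 2 ≤ s) (hst : s < t) (f : StarVert s t m ↪ V)
    (hG : ¬ HasDoubleStar G s t) (hf : ∀ a b, (starUnion s t m).Adj a b → G.Adj (f a) (f b))
    {x : V} (hx : x ∉ univ.image f) : (nbhd G x).card ≤ s + (univ \ univ.image f).card := by
  have hleaf : ∀ z, ¬ G.Adj x (f (.inr (.inr z))) := fun z h =>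
    hG (hasDoubleStar_of_leaf hs hst f.injective hf h.symm
      fun h' => hx (image_subset_image (subset_univ _) h'))
  -- Attachment to a centre forces degree below `s`; without it, all neighbours lie in the clique or
  -- outside the copy.
  by_cases hc : ∃ c, G.Adj x (f (.inr (.inl c)))
  · obtain ⟨c, hc⟩ := hc
    by_contra! h
    exact hG (hasDoubleStar_of_center f.injective hf hc (by omega) fun j => hleaf _)
  · push Not at hc
    have hsub : nbhd G x ⊆ (univ.image fun a : Fin s => f (.inl a)) ∪ (univ \ univ.image f) := by
      intro y hy
      rw [mem_nbhd] at hy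
      by_cases hy' : y ∈ univ.image f
      · obtain ⟨a | c | z, -, rfl⟩ := mem_image.1 hy'
        · exact mem_union_left _ (mem_image_of_mem _ (mem_univ _))
        · exact absurd hy (hc c)
        · exact absurd hy (hleaf z)
      · exact mem_union_right _ (mem_sdiff.2 ⟨mem_univ _, hy'⟩)
    have h1 := card_le_card hsub
    have h2 := card_union_le (univ.image fun a : Fin s => f (.inl a)) (univ \ univ.image f)
    have h3 : (univ.image fun a : Fin s => f (.inl a)).card ≤ s := by
      simpa using card_image_le (s := univ) (f := fun a : Fin s => f (.inl a))
    omega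

/-- The copy is already saturated, so it is induced in `G`, and all further edges meet the vertices
outside it. Their degrees are bounded; the factor 2 covers edges into the copy, which are counted at
both ends. -/
theorem two_mul_ncard_edgeSet_le (hs : 2 ≤ s) (hst : s < t) (f : StarVert s t m ↪ V)
    (hG : ¬ HasDoubleStar G s t) (hf : ∀ a b, (starUnion s t m).Adj a b → G.Adj (f a) (f b)) :
    2 * G.edgeSet.ncard ≤ s * (s - 1) + 2 * m * (s * (t + 1)) +
      2 * ((univ \ univ.image f).card * (s + (univ \ univ.image f).card)) := by
  classical
  set R := univ \ univ.image f with hR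
  have hold : ∀ a b, G.Adj (f a) (f b) → (starUnion s t m).Adj a b := by
    intro a b hab
    by_contra hnot
    have hne : a ≠ b := fun h => hab.ne (congrArg f h)
    refine hG (doubleStar_isContained_iff (hs := by omega) (ht := by omega) |>.1 ?_)
    refine (doubleStar_isContained_iff.2
      (hasDoubleStar_starUnion_sup_edge hs hst hne hnot)).trans ⟨⟨⟨f, ?_⟩, f.injective⟩⟩
    intro c d hcd
    rcases hcd with hcd | hcd
    · exact hf c d hcd
    · rw [SimpleGraph.edge_adj] at hcd
      obtain ⟨⟨rfl, rfl⟩ | ⟨rfl, rfl⟩, -⟩ := hcd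
      · exact hab
      · exact hab.symm
  have hRdeg : ∑ x ∈ R, (nbhd G x).card ≤ R.card * (s + R.card) := by
    rw [← smul_eq_mul]
    exact sum_le_card_nsmul _ _ _ fun x hx =>
      card_nbhd_le_of_notMem_range hs hst f hG hf (mem_sdiff.1 hx).2
  have hdeg : ∀ a, (nbhd G (f a)).card ≤
      (nbhd (starUnion s t m) a).card + ∑ x ∈ R, if G.Adj (f a) x then 1 else 0 := by
    intro a
    rw [← card_filter, ← card_map f]
    refine le_trans (card_le_card ?_) (card_union_le _ _)
    intro y hy
    rw [mem_nbhd] at hy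
    by_cases hy' : y ∈ univ.image f
    · obtain ⟨b, -, rfl⟩ := mem_image.1 hy'
      exact mem_union_left _ (mem_map_of_mem f (mem_nbhd.2 (hold _ _ hy)))
    · exact mem_union_right _ (mem_filter.2 ⟨mem_sdiff.2 ⟨mem_univ _, hy'⟩, hy⟩)
  have hcross : ∑ a, ∑ x ∈ R, (if G.Adj (f a) x then 1 else 0) ≤ ∑ x ∈ R, (nbhd G x).card := by
    rw [sum_comm]
    refine sum_le_sum fun x _ => ?_
    rw [← card_filter, ← card_map f]
    refine card_le_card fun y hy => ?_
    obtain ⟨a, ha, rfl⟩ := mem_map.1 hy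
    simpa using (mem_filter.1 ha).2.symm
  have hin : ∑ a, (nbhd G (f a)).card ≤
      s * (s - 1) + 2 * m * (s * (t + 1)) + ∑ x ∈ R, (nbhd G x).card := by
    refine (sum_le_sum fun a _ => hdeg a).trans ?_
    rw [sum_add_distrib, sum_card_nbhd_starUnion hs hst]
    omega
  have hsplit : 2 * G.edgeSet.ncard = ∑ x ∈ R, (nbhd G x).card + ∑ a, (nbhd G (f a)).card := by
    rw [← sum_card_nbhd, ← sum_sdiff (subset_univ (univ.image f)),
      sum_image f.injective.injOn]
  omega

/-- Saturated graphs of every large order with few edges. -/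
theorem exists_isSaturated_doubleStar (hs : 2 ≤ s) (hst : s < t) {r : ℕ} {hs' : 0 < s}
    {ht : 0 < t} : ∃ G : SimpleGraph (Fin (s + 2 * m * (t + 2) + r)),
      IsSaturated (doubleStar s t hs' ht) G ∧
        2 * G.edgeSet.ncard ≤ s * (s - 1) + 2 * m * (s * (t + 1)) + 2 * (r * (s + r)) := by
  obtain ⟨f⟩ : Nonempty (StarVert s t m ↪ Fin (s + 2 * m * (t + 2) + r)) := by
    apply Function.Embedding.nonempty_of_card_le
    rw [card_starVert, Fintype.card_fin]
    omega
  obtain ⟨G, hle, hG⟩ := Finite.exists_le_maximal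
    (p := fun G : SimpleGraph (Fin (s + 2 * m * (t + 2) + r)) => ¬ HasDoubleStar G s t)
    (not_hasDoubleStar_map_starUnion hs hst f)
  refine ⟨G, ?_, ?_⟩
  · rw [isSaturated_doubleStar_iff]
    refine ⟨hG.prop, fun x y hxy hadj => ?_⟩
    by_contra hfree
    have hle := hG.le_of_ge (y := G ⊔ SimpleGraph.edge x y) hfree le_sup_left
    exact hadj (hle (Or.inr (by simp [SimpleGraph.edge_adj, hxy])))
  · have h := two_mul_ncard_edgeSet_le hs hst f hG.prop
      fun a b hab => hle ((SimpleGraph.map_adj f _ _ _).2 ⟨a, b, hab, rfl, rfl⟩)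
    have hr : (univ \ univ.image f).card = r := by
      rw [card_sdiff_of_subset (subset_univ _), card_image_of_injective _ f.injective,
        card_univ, card_univ, card_starVert, Fintype.card_fin]
      omega
    rwa [hr] at h

end Construction

/-! ### Bounds on the saturation number and conclusion -/

theorem satNumber_le {W : Type*} {n : ℕ} {H : SimpleGraph W} {G : SimpleGraph (Fin n)}
    (hG : IsSaturated H G) : satNumber n H ≤ G.edgeSet.ncard :=
  Nat.sInf_le ⟨G, hG, rfl⟩

theorem doubleStar_ne_bot {s t : ℕ} (hs : 0 < s) (ht : 0 < t) : doubleStar s t hs ht ≠ ⊥ := by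
  intro h
  have : (doubleStar s t hs ht).Adj (Sum.inl ⟨0, hs⟩) (Sum.inr ⟨0, ht⟩) := by
    simp [doubleStar, SimpleGraph.edge_adj]
  rw [h] at this
  exact this

theorem two_mul_satNumber_le {s t m r : ℕ} (hs : 2 ≤ s) (hst : s < t) {hs' : 0 < s} {ht : 0 < t} :
    2 * satNumber (s + 2 * m * (t + 2) + r) (doubleStar s t hs' ht) ≤
      s * (s - 1) + 2 * m * (s * (t + 1)) + 2 * (r * (s + r)) := by
  obtain ⟨G, hG, h⟩ := exists_isSaturated_doubleStar (m := m) hs hst (r := r) (hs' := hs')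
    (ht := ht)
  have := satNumber_le hG
  omega

theorem exists_eq_add_mul {s n : ℕ} (t : ℕ) (h : s ≤ n) :
    ∃ m r, r < 2 * t + 4 ∧ n = s + 2 * m * (t + 2) + r := by
  refine ⟨(n - s) / (2 * t + 4), (n - s) % (2 * t + 4), Nat.mod_lt _ (by omega), ?_⟩
  have h1 := Nat.div_add_mod (n - s) (2 * t + 4)
  have h2 : 2 * ((n - s) / (2 * t + 4)) * (t + 2) = (2 * t + 4) * ((n - s) / (2 * t + 4)) := by
    ring
  omega

/-- The total excess of an extremal graph is bounded. -/
theorem excess_satNumber_le {s t n : ℕ} (hs : 2 ≤ s) (hst : s < t) (hn : s ≤ n) {hs' : 0 < s}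
    {ht : 0 < t} : ((t : ℤ) + 2) * (2 * satNumber n (doubleStar s t hs' ht)) - s * (t + 1) * n ≤
      (t + 2) * (s ^ 2 + 2 * ((2 * t + 4) * (s + (2 * t + 4)))) := by
  obtain ⟨m, r, hr, rfl⟩ := exists_eq_add_mul t hn
  have h1 := two_mul_satNumber_le (m := m) (r := r) hs hst (hs' := hs') (ht := ht)
  have h2 : s * (s - 1) ≤ s ^ 2 := by
    rw [sq]
    exact Nat.mul_le_mul_left _ (Nat.sub_le _ _)
  have h3 : r * (s + r) ≤ (2 * t + 4) * (s + (2 * t + 4)) := by gcongr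
  have h4 : 2 * satNumber (s + 2 * m * (t + 2) + r) (doubleStar s t hs' ht) ≤
      s ^ 2 + 2 * ((2 * t + 4) * (s + (2 * t + 4))) + 2 * m * (s * (t + 1)) := by omega
  zify at h4
  have h5 := mul_le_mul_of_nonneg_left h4 (by positivity : (0 : ℤ) ≤ t + 2)
  have h6 : (0 : ℤ) ≤ s * (t + 1) * (s + r) := by positivity
  push_cast at h5 ⊢
  linarith

/-- In an extremal graph of large order, all degrees are at least `s - 1`. -/
theorem le_card_nbhd_of_extremal {s t n : ℕ} (hs : 0 < s) (hst : s < t)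
    (hn : 4 * (t + 1) * ((t + 2) * (s ^ 2 + 2 * ((2 * t + 4) * (s + (2 * t + 4))))) +
      (8 * s ^ 2 * (t + 1) ^ 2 + 2 * s) < n) {G : SimpleGraph (Fin n)}
    (hG : IsSaturated (doubleStar s t hs (hs.trans hst)) G)
    (hmin : G.edgeSet.ncard = satNumber n (doubleStar s t hs (hs.trans hst))) (v : Fin n) :
    s ≤ (nbhd G v).card + 1 := by
  by_contra! hv
  obtain ⟨hfree, hsat⟩ := isSaturated_doubleStar_iff.1 hG
  have h1 := card_le_sum_excess hs hst hfree hsat hv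
  -- A degree below `s - 1` forces `2 ≤ s`, as the construction requires.
  have h2 := excess_satNumber_le (n := n) (by omega : 2 ≤ s) hst (by omega) (hs' := hs)
    (ht := hs.trans hst)
  rw [sum_excess, hmin, Fintype.card_fin] at h1
  have h3 := mul_le_mul_of_nonneg_left h2 (by positivity : (0 : ℤ) ≤ 4 * (t + 1))
  zify at hn
  linarith

theorem mainTheorem4 (s t : ℕ) (hs : 0 < s) (hst : s < t) :
    ∃ N : ℕ, ∀ n : ℕ, N ≤ n →
      ((s : ℝ) * (t + 1) * n - s * (t - s + 2)) / (2 * t + 4)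
          ≤ (satNumber n (doubleStar s t hs (hs.trans hst)) : ℝ) ∧
      (2 ≤ s → n ≡ s [MOD 2 * t + 4] →
        (satNumber n (doubleStar s t hs (hs.trans hst)) : ℝ)
          = ((s : ℝ) * (t + 1) * n - s * (t - s + 2)) / (2 * t + 4)) ∧
      (∀ G : SimpleGraph (Fin n),
        IsSaturated (doubleStar s t hs (hs.trans hst)) G →
        G.edgeSet.ncard = satNumber n (doubleStar s t hs (hs.trans hst)) →
        ∀ v : Fin n, s - 1 ≤ (G.neighborSet v).ncard) := by
  refine ⟨4 * (t + 1) * ((t + 2) * (s ^ 2 + 2 * ((2 * t + 4) * (s + (2 * t + 4))))) +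
      (8 * s ^ 2 * (t + 1) ^ 2 + 2 * s) + 1, fun n hn => ?_⟩
  have hpos : (0 : ℝ) < 2 * t + 4 := by positivity
  have hlower : ((s : ℝ) * (t + 1) * n - s * (t - s + 2)) / (2 * t + 4)
      ≤ (satNumber n (doubleStar s t hs (hs.trans hst)) : ℝ) := by
    obtain ⟨G, hG, hmin⟩ := exists_isSaturated_card_eq_satNumber n
      (doubleStar s t hs (hs.trans hst)) (doubleStar_ne_bot _ _)
    obtain ⟨hfree, hsat⟩ := isSaturated_doubleStar_iff.1 hG
    have h := neg_le_sum_excess hs hst hfree hsat (le_card_nbhd_of_extremal hs hst hn hG hmin)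
    rw [sum_excess, hmin, Fintype.card_fin] at h
    have h' : (-((s : ℝ) * (t + 2 - s))) ≤
        (t + 2) * (2 * satNumber n (doubleStar s t hs (hs.trans hst))) - s * (t + 1) * n := by
      exact_mod_cast h
    rw [div_le_iff₀ hpos]
    linarith
  refine ⟨hlower, fun hs2 hmod => le_antisymm ?_ hlower, fun G hG hmin v => ?_⟩
  · have hsn : s ≤ n := by omega
    obtain ⟨m, hm⟩ := (Nat.modEq_iff_dvd' hsn).1 hmod.symm
    -- With no leftover vertices, the stars have zero excess and the clique contributes exactly
    -- `-s(t + 2 - s)`.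
    have hnm : n = s + 2 * m * (t + 2) + 0 := by
      have : 2 * m * (t + 2) = (2 * t + 4) * m := by ring
      omega
    subst hnm
    have h := two_mul_satNumber_le (m := m) (r := 0) hs2 hst (hs' := hs) (ht := hs.trans hst)
    have h' : (2 * (satNumber (s + 2 * m * (t + 2) + 0)
        (doubleStar s t hs (hs.trans hst)) : ℝ)) ≤
        s * (s - 1) + 2 * m * (s * (t + 1)) := by
      have h1 : ((s - 1 : ℕ) : ℝ) = s - 1 := by
        rw [Nat.cast_sub hs, Nat.cast_one]
      rw [← h1]
      have h2 : 2 * satNumber (s + 2 * m * (t + 2) + 0) (doubleStar s t hs (hs.trans hst)) ≤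
          s * (s - 1) + 2 * m * (s * (t + 1)) := by omega
      exact_mod_cast h2
    have h3 := mul_le_mul_of_nonneg_left h' (by positivity : (0 : ℝ) ≤ t + 2)
    rw [le_div_iff₀ hpos]
    push_cast at h3 ⊢
    linarith
  · have := le_card_nbhd_of_extremal hs hst hn hG hmin v
    rw [ncard_neighborSet]
    omega
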